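/- Let $X \subset \mathbb{R}^3$ be a set of exactly $12$ points. Let $G = DG(X)$ be its diameter graph: the vertices of $G$ are the points of $X$, and two distinct points $P, Q \in X$ are adjacent if and only if their Euclidean distance $|PQ|$ equals the maximum of the distances between two distinct points of $X$. Then the independence number $\alpha(G)$, that is, the maximum cardinality of a set of pairwise non-adjacent vertices of $G$, satisfies $$\alpha(G) \ge 5 .$$ -/

import Mathlib

/-- The set `A(X)` of the distances between two distinct points of `X`. -/
def distanceSet {E : Type*} [MetricSpace E] (X : Set E) : Set ℝ :=
  {r | ∃ P ∈ X, ∃ Q ∈ X, P ≠ Q ∧ dist P Q = r}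

/-- The diameter graph `DG(X)`: its vertices are the points of `X`, and two of them are adjacent
if their distance is the maximum of `A(X)`. -/
def diameterGraph {E : Type*} [MetricSpace E] (X : Set E) : SimpleGraph X where
  Adj P Q := P ≠ Q ∧ IsGreatest (distanceSet X) (dist P Q)
  symm := ⟨fun P Q h => ⟨h.1.symm, dist_comm P Q ▸ h.2⟩⟩
  loopless := ⟨fun _ h => h.1 rfl⟩

/-!
The theorem combines a topological fact about diameter graphs in space with a purely combinatorial
argument on twelve vertices.

*Any two odd cycles of a diameter graph in `ℝ³` have a common vertex* (`odd_diameter_walks_meet`).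
For a closed walk `x₀, x₁, …` of odd length `k` along diameters, the vectors
`uᵢ = (-1)ⁱ (xᵢ₊₁ - xᵢ)` satisfy `uᵢ₊ₖ = -uᵢ`, so they trace a polygon on the sphere from a point to
its antipode, and the arc from `uᵢ` to `uᵢ₊₁` lies, up to sign, in the cone of the directions of the
two diameters at `xᵢ₊₁`.  Two such polygons always meet up to sign (`exists_arcsMeet`): in general
position their number of crossings is odd, which is computed from signs of determinants
(`sum_crossing_eq_one`), and the general case follows by a small perturbation and compactness.  On
the other hand the cones at distinct vertices `x, y` of two disjoint walks are disjoint, also after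
reflecting one of them; this is a computation with inner products (`cone_ne_cone`,
`cone_ne_neg_cone`).

*A graph on twelve vertices in which any two odd cycles meet has five independent vertices*
(`SimpleGraph.exists_isIndepSet_of_oddCyclesMeet`).  Suppose not.  The complement of any odd cycle is
bipartite, so a triangle would leave nine vertices and an independent set of size five.  Hence
neighbourhoods are independent and degrees are at most four.  The non-neighbours of a vertex `v` of
degree four are seven vertices that do not induce a bipartite graph, so they contain a pentagon or
an induced heptagon, and both are excluded (`SimpleGraph.PentagonPair.false_of_degree_eq_four`,
`SimpleGraph.heptagon_false_of_degree_eq_four`).  If all degrees are at most three, then a pentagon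
is impossible (`SimpleGraph.pentagon_false_of_degree_le_three`), but a vertex of degree three forces
one (`SimpleGraph.exists_pentagon_of_degree_eq_three`); and if all degrees are at most two, the
greedy algorithm finds five independent vertices.
-/

/-! ### Crossing parity of antiperiodic polygons -/

/-- The sign of a nonzero real number, as an element of `ZMod 2` (`1` for positive). -/
noncomputable def signBit (x : ℝ) : ZMod 2 := if 0 < x then 1 else 0

lemma signBit_neg {x : ℝ} (hx : x ≠ 0) : signBit (-x) = signBit x + 1 := by
  unfold signBit
  rcases lt_or_gt_of_ne hx with h | h
  · simp [h, h.le]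
  · simp only [neg_pos, not_lt_of_gt h, if_false, h, if_true]; decide

lemma signBit_mul {x y : ℝ} (hx : x ≠ 0) (hy : y ≠ 0) :
    signBit (x * y) = signBit x + signBit y + 1 := by
  unfold signBit
  rcases lt_or_gt_of_ne hx with h | h <;> rcases lt_or_gt_of_ne hy with h' | h'
  · rw [if_pos (mul_pos_of_neg_of_neg h h'), if_neg h.not_gt, if_neg h'.not_gt]; decide
  · rw [if_neg (mul_neg_of_neg_of_pos h h').not_gt, if_neg h.not_gt, if_pos h']; decide
  · rw [if_neg (mul_neg_of_pos_of_neg h h').not_gt, if_pos h, if_neg h'.not_gt]; decide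
  · rw [if_pos (mul_pos h h'), if_pos h, if_pos h']; decide

lemma mul_neg_of_signBit_ne {x y : ℝ} (hx : x ≠ 0) (hy : y ≠ 0)
    (h : signBit x + signBit y ≠ 0) : x * y < 0 := by
  by_contra hlt
  have h1 := signBit_mul hx hy
  rw [signBit, if_pos (lt_of_le_of_ne (not_lt.1 hlt) (mul_ne_zero hx hy).symm)] at h1
  exact h (by simpa using h1.symm)

/-- If `xw` and `yz` have opposite signs, then `xw - yz` has the sign of `xw`; the disjunction is
written as a vanishing product in `ZMod 2`. -/
lemma signBit_sub {D p x w y z : ℝ} (hD : D ≠ 0) (hp : p ≠ 0) (hx : x ≠ 0) (hw : w ≠ 0)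
    (hy : y ≠ 0) (hz : z ≠ 0) (h : D * p = x * w - y * z) :
    (signBit x + signBit w + signBit y + signBit z) *
      (signBit D + signBit p + signBit x + signBit w) = 0 := by
  have e1 := signBit_mul hD hp
  have e2 := signBit_mul hx hw
  have e3 := signBit_mul hy hz
  rw [h] at e1
  have key : (signBit (x * w) + signBit (y * z)) *
      (signBit (x * w - y * z) + signBit (x * w)) = 0 := by
    unfold signBit
    rcases lt_or_gt_of_ne (mul_ne_zero hx hw) with h1 | h1 <;>
    rcases lt_or_gt_of_ne (mul_ne_zero hy hz) with h2 | h2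
    · simp [h1.not_gt, h2.not_gt]
    · rw [if_neg h1.not_gt, if_pos h2, if_neg (by linarith)]; decide
    · rw [if_pos h1, if_neg h2.not_gt, if_pos (by linarith)]; decide
    · rw [if_pos h1, if_pos h2]
      have : (1 + 1 : ZMod 2) = 0 := by decide
      rw [this, zero_mul]
  rw [e1, e2, e3] at key
  generalize signBit D = d at *
  generalize signBit p = p at *
  generalize signBit x = x at *
  generalize signBit y = y at *
  generalize signBit z = z at *
  generalize signBit w = w at *
  clear e1 e2 e3
  revert key
  revert d p x y z w
  decide

/-- The determinant of three vectors of `ℝ³`. -/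
def det3 (a b c : Fin 3 → ℝ) : ℝ :=
  a 0 * (b 1 * c 2 - b 2 * c 1) - a 1 * (b 0 * c 2 - b 2 * c 0) + a 2 * (b 0 * c 1 - b 1 * c 0)

lemma det3_rotate (a b c : Fin 3 → ℝ) : det3 b c a = det3 a b c := by unfold det3; ring

lemma det3_swap (a b c : Fin 3 → ℝ) : det3 b a c = -det3 a b c := by unfold det3; ring

lemma det3_neg_mid (a b c : Fin 3 → ℝ) : det3 a (-b) c = -det3 a b c := by
  simp only [det3, Pi.neg_apply]; ring

lemma det3_neg_right (a b c : Fin 3 → ℝ) : det3 a b (-c) = -det3 a b c := by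
  simp only [det3, Pi.neg_apply]; ring

lemma det3_neg_left (a b c : Fin 3 → ℝ) : det3 (-a) b c = -det3 a b c := by
  simp only [det3, Pi.neg_apply]; ring

/-- The Grassmann–Plücker relation. -/
lemma det3_mul_det3 (a b c d e : Fin 3 → ℝ) :
    det3 a b c * det3 a d e = det3 c a d * det3 a b e - det3 a b d * det3 c a e := by
  unfold det3; ring

/-- Cramer's linear relation between four vectors of `ℝ³`. -/
lemma det3_relation (a b d e : Fin 3 → ℝ) :
    det3 b d e • a - det3 a d e • b = det3 a b d • e - det3 a b e • d := by
  ext i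
  fin_cases i <;> simp [det3] <;> ring

/-- Whether the projective segments `ab` and `de` cross: `1` if the great circle through `a, b`
separates `d` from `e` and the one through `d, e` separates `a` from `b`, and `0` otherwise.
The sphere arc from `a` to `b` then meets the arc from `d` to `e` or its antipode. -/
noncomputable def crossing (a b d e : Fin 3 → ℝ) : ZMod 2 :=
  (signBit (det3 a b d) + signBit (det3 a b e)) * (signBit (det3 a d e) + signBit (det3 b d e))

/-- Whether `d` or `-d` lies in the cone spanned by `a, b, c`, for vectors in general position. -/
noncomputable def inTriangle (a b c d : Fin 3 → ℝ) : ZMod 2 :=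
  (signBit (det3 b c d) + signBit (det3 c a d) + 1) *
    (signBit (det3 c a d) + signBit (det3 a b d) + 1)

lemma inTriangle_neg {a b c d : Fin 3 → ℝ} (h1 : det3 b c d ≠ 0) (h2 : det3 c a d ≠ 0)
    (h3 : det3 a b d ≠ 0) : inTriangle a b c (-d) = inTriangle a b c d := by
  simp only [inTriangle, det3_neg_right, signBit_neg h1, signBit_neg h2, signBit_neg h3]
  generalize signBit (det3 b c d) = x
  generalize signBit (det3 c a d) = y
  generalize signBit (det3 a b d) = z
  revert x y z; decide

/-- The sign pattern behind `crossing_triangle`: `dᵢ` and `eᵢ` are the signs of the coordinates of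
two vectors, `pᵢ` those of their cross product, and `D` is the orientation of the basis. -/
lemma zmod_two_triangle : ∀ d1 d2 d3 e1 e2 e3 D p1 p2 p3 : ZMod 2,
    (d2 + e3 + d3 + e2) * (D + p1 + d2 + e3) = 0 →
    (d3 + e1 + d1 + e3) * (D + p2 + d3 + e1) = 0 →
    (d1 + e2 + d2 + e1) * (D + p3 + d1 + e2) = 0 →
    (d3 + e3) * (p1 + p2) + (d1 + e1) * (p2 + p3) + (d2 + e2) * (p3 + p1) =
      (d1 + d2 + 1) * (d2 + d3 + 1) + (e1 + e2 + 1) * (e2 + e3 + 1) := by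
  decide

/-- A segment meets the boundary of a triangle oddly often exactly when one of its two ends is
inside. -/
lemma crossing_triangle {a b c d e : Fin 3 → ℝ} (hD : det3 a b c ≠ 0)
    (d1 : det3 b c d ≠ 0) (d2 : det3 c a d ≠ 0) (d3 : det3 a b d ≠ 0)
    (e1 : det3 b c e ≠ 0) (e2 : det3 c a e ≠ 0) (e3 : det3 a b e ≠ 0)
    (p1 : det3 a d e ≠ 0) (p2 : det3 b d e ≠ 0) (p3 : det3 c d e ≠ 0) :
    crossing a b d e + crossing b c d e + crossing c a d e =
      inTriangle a b c d + inTriangle a b c e := by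
  have hD2 : det3 b c a ≠ 0 := by rwa [det3_rotate]
  have hD3 : det3 c a b ≠ 0 := by rwa [det3_rotate, det3_rotate]
  have k1 := signBit_sub hD p1 d2 e3 d3 e2 (det3_mul_det3 a b c d e)
  have k2 := signBit_sub hD2 p2 d3 e1 d1 e3 (det3_mul_det3 b c a d e)
  have k3 := signBit_sub hD3 p3 d1 e2 d2 e1 (det3_mul_det3 c a b d e)
  rw [det3_rotate a b c] at k2
  rw [← det3_rotate c a b] at k3
  exact zmod_two_triangle _ _ _ _ _ _ _ _ _ _ k1 k2 k3

lemma crossing_swap {a b d e : Fin 3 → ℝ} (hd : det3 a b d ≠ 0) (he : det3 a b e ≠ 0) :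
    crossing b a d e = crossing a b d e := by
  simp only [crossing, det3_swap a b, signBit_neg hd, signBit_neg he]
  generalize signBit (det3 a b d) = x
  generalize signBit (det3 a b e) = y
  generalize signBit (det3 a d e) = z
  generalize signBit (det3 b d e) = w
  revert x y z w; decide

lemma crossing_add_crossing_neg {n a d e : Fin 3 → ℝ} (hd : det3 n a d ≠ 0)
    (he : det3 n a e ≠ 0) (h : det3 a d e ≠ 0) :
    crossing n a d e + crossing n (-a) d e = signBit (det3 n a d) + signBit (det3 n a e) := by
  simp only [crossing, det3_neg_mid, det3_neg_left, signBit_neg hd, signBit_neg he, signBit_neg h]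
  generalize signBit (det3 n a d) = x
  generalize signBit (det3 n a e) = y
  generalize signBit (det3 a d e) = z
  generalize signBit (det3 n d e) = w
  revert x y z w; decide

lemma sum_range_add_succ_zmod_two (f : ℕ → ZMod 2) (m : ℕ) :
    ∑ j ∈ Finset.range m, (f j + f (j + 1)) = f 0 + f m := by
  induction m with
  | zero => simp [CharTwo.add_self_eq_zero]
  | succ m ih =>
    rw [Finset.sum_range_succ, ih]
    have : f 0 + f m + (f m + f (m + 1)) = f 0 + f (m + 1) + (f m + f m) := by ring
    rw [this, CharTwo.add_self_eq_zero, add_zero]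

/-- Two closed polygons in the projective plane, each lifting to a path from a point of the sphere
to its antipode, cross an odd number of times if they are in general position together with an
auxiliary pole `n`.  Let `g a` count the crossings of `w` with the arc from `n` to `a`.  By
`crossing_triangle`, summed around the closed polygon `w`, an arc from `a` to `b` is crossed
`g a + g b` times modulo two; so the total telescopes to `g (u 0) + g (-u 0)`, which is `1` because
the half circle from `u 0` through `n` to `-u 0` cuts `w` an odd number of times. -/
lemma sum_crossing_eq_one {k m : ℕ} {u w : ℕ → Fin 3 → ℝ} {n : Fin 3 → ℝ}
    (hu : u k = -u 0) (hw : w m = -w 0)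
    (h1 : ∀ i < k, det3 n (u i) (u (i + 1)) ≠ 0)
    (h2 : ∀ i ≤ k, ∀ j ≤ m, det3 n (u i) (w j) ≠ 0)
    (h3 : ∀ i < k, ∀ j ≤ m, det3 (u i) (u (i + 1)) (w j) ≠ 0)
    (h4 : ∀ i ≤ k, ∀ j < m, det3 (u i) (w j) (w (j + 1)) ≠ 0)
    (h5 : ∀ j < m, det3 n (w j) (w (j + 1)) ≠ 0) :
    ∑ i ∈ Finset.range k, ∑ j ∈ Finset.range m,
      crossing (u i) (u (i + 1)) (w j) (w (j + 1)) = 1 := by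
  set g : (Fin 3 → ℝ) → ZMod 2 := fun a =>
    ∑ j ∈ Finset.range m, crossing n a (w j) (w (j + 1)) with hg
  have step : ∀ i < k, ∑ j ∈ Finset.range m, crossing (u i) (u (i + 1)) (w j) (w (j + 1)) =
      g (u i) + g (u (i + 1)) := by
    intro i hi
    have tri : ∑ j ∈ Finset.range m, (crossing n (u i) (w j) (w (j + 1)) +
        crossing (u i) (u (i + 1)) (w j) (w (j + 1)) +
        crossing n (u (i + 1)) (w j) (w (j + 1))) = 0 := by
      have hn : ∀ j ≤ m, det3 (u (i + 1)) n (w j) ≠ 0 := fun j hj => by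
        rw [det3_swap]; exact neg_ne_zero.2 (h2 (i + 1) hi j hj)
      calc _ = ∑ j ∈ Finset.range m, (inTriangle n (u i) (u (i + 1)) (w j) +
            inTriangle n (u i) (u (i + 1)) (w (j + 1))) := by
            refine Finset.sum_congr rfl fun j hj => ?_
            have hj' : j < m := Finset.mem_range.1 hj
            rw [← crossing_triangle (h1 i hi) (h3 i hi j hj'.le) (hn j hj'.le)
              (h2 i hi.le j hj'.le) (h3 i hi (j + 1) hj') (hn (j + 1) hj') (h2 i hi.le (j + 1) hj')
              (h5 j hj') (h4 i hi.le j hj') (h4 (i + 1) hi j hj'),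
              crossing_swap (h2 (i + 1) hi j hj'.le) (h2 (i + 1) hi (j + 1) hj')]
        _ = _ := by
            rw [sum_range_add_succ_zmod_two (fun j => inTriangle n (u i) (u (i + 1)) (w j)), hw,
              inTriangle_neg (h3 i hi 0 (Nat.zero_le _)) (hn 0 (Nat.zero_le _))
                (h2 i hi.le 0 (Nat.zero_le _)), CharTwo.add_self_eq_zero]
    rw [Finset.sum_add_distrib, Finset.sum_add_distrib] at tri
    change g (u i) + _ + g (u (i + 1)) = 0 at tri
    generalize g (u i) = x at *
    generalize g (u (i + 1)) = y at *
    generalize (∑ j ∈ Finset.range m, crossing (u i) (u (i + 1)) (w j) (w (j + 1))) = z at *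
    clear hg h1 h2 h3 h4 h5 hu
    revert tri
    revert x y z
    decide
  rw [Finset.sum_congr rfl fun i hi => step i (Finset.mem_range.1 hi),
    sum_range_add_succ_zmod_two (fun i => g (u i)), hu]
  simp only [hg]
  rw [← Finset.sum_add_distrib, Finset.sum_congr rfl fun j hj => crossing_add_crossing_neg
    (h2 0 (Nat.zero_le _) j (Finset.mem_range.1 hj).le)
    (h2 0 (Nat.zero_le _) (j + 1) (Finset.mem_range.1 hj))
    (h4 0 (Nat.zero_le _) j (Finset.mem_range.1 hj)),
    sum_range_add_succ_zmod_two (fun j => signBit (det3 n (u 0) (w j))), hw, det3_neg_right,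
    signBit_neg (h2 0 (Nat.zero_le _) 0 (Nat.zero_le _)), ← add_assoc, CharTwo.add_self_eq_zero,
    zero_add]

/-- The arc from `a` to `b` meets the arc from `d` to `e` or its antipode, expressed by
coefficients in the standard simplex (degenerate arcs are allowed). -/
def ArcsMeet (a b d e : Fin 3 → ℝ) : Prop :=
  ∃ z ∈ stdSimplex ℝ (Fin 4), ∃ ε : ℤˣ,
    z 0 • a + z 1 • b = ((ε : ℤ) : ℝ) • (z 2 • d + z 3 • e)

lemma arcsMeet_of_crossing {a b d e : Fin 3 → ℝ} (h1 : det3 a b d ≠ 0) (h2 : det3 a b e ≠ 0)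
    (h3 : det3 a d e ≠ 0) (h4 : det3 b d e ≠ 0) (h : crossing a b d e ≠ 0) :
    ArcsMeet a b d e := by
  have hl := mul_neg_of_signBit_ne h1 h2 (left_ne_zero_of_mul h)
  have hr := mul_neg_of_signBit_ne h3 h4 (right_ne_zero_of_mul h)
  have rel := det3_relation a b d e
  set s := |det3 b d e| + |det3 a d e| + |det3 a b e| + |det3 a b d| with hs
  have hs0 : 0 < s := by positivity
  have main : ∃ ε : ℤˣ, |det3 b d e| • a + |det3 a d e| • b =
      ((ε : ℤ) : ℝ) • (|det3 a b e| • d + |det3 a b d| • e) := by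
    rcases lt_or_gt_of_ne h1 with h1 | h1 <;> rcases lt_or_gt_of_ne h3 with h3 | h3
    · have h2 : 0 < det3 a b e := by nlinarith
      have h4 : 0 < det3 b d e := by nlinarith
      refine ⟨-1, ?_⟩
      rw [abs_of_neg h1, abs_of_pos h2, abs_of_neg h3, abs_of_pos h4]
      ext i; have := congrFun rel i; simp at this ⊢; linarith
    · have h2 : 0 < det3 a b e := by nlinarith
      have h4 : det3 b d e < 0 := by nlinarith
      refine ⟨1, ?_⟩
      rw [abs_of_neg h1, abs_of_pos h2, abs_of_pos h3, abs_of_neg h4]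
      ext i; have := congrFun rel i; simp at this ⊢; linarith
    · have h2 : det3 a b e < 0 := by nlinarith
      have h4 : 0 < det3 b d e := by nlinarith
      refine ⟨1, ?_⟩
      rw [abs_of_pos h1, abs_of_neg h2, abs_of_neg h3, abs_of_pos h4]
      ext i; have := congrFun rel i; simp at this ⊢; linarith
    · have h2 : det3 a b e < 0 := by nlinarith
      have h4 : det3 b d e < 0 := by nlinarith
      refine ⟨-1, ?_⟩
      rw [abs_of_pos h1, abs_of_neg h2, abs_of_pos h3, abs_of_neg h4]
      ext i; have := congrFun rel i; simp at this ⊢; linarith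
  obtain ⟨ε, hε⟩ := main
  refine ⟨![|det3 b d e| / s, |det3 a d e| / s, |det3 a b e| / s, |det3 a b d| / s],
    ⟨fun i => ?_, ?_⟩, ε, ?_⟩
  · fin_cases i <;> simp <;> positivity
  · rw [Fin.sum_univ_four]
    simp
    field_simp
    rw [hs]
  · ext i
    have := congrFun hε i
    simp at this ⊢
    field_simp at this ⊢
    linarith

open Filter Topology

/-! ### Perturbation to general position -/

/-- A point of the moment curve `(1, s, s²)`. -/
def momentPoint (s : ℝ) : Fin 3 → ℝ := ![1, s, s ^ 2]

/-- Moving three vectors along multiples of distinct points of the moment curve makes them linearly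
independent at all small positive times: the determinant is a cubic in `t` whose leading
coefficient is a Vandermonde determinant. -/
lemma eventually_det3_ne_zero (a b c : Fin 3 → ℝ) {x y z r s t : ℝ} (hx : x ≠ 0) (hy : y ≠ 0)
    (hz : z ≠ 0) (hrs : r ≠ s) (hrt : r ≠ t) (hst : s ≠ t) :
    ∀ᶠ τ in 𝓝[>] (0 : ℝ), det3 (a + (τ * x) • momentPoint r) (b + (τ * y) • momentPoint s)
      (c + (τ * z) • momentPoint t) ≠ 0 := by
  set p : Polynomial ℝ :=
    Polynomial.C (det3 a b c) +
    Polynomial.C (det3 (x • momentPoint r) b c + det3 a (y • momentPoint s) c +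
      det3 a b (z • momentPoint t)) * Polynomial.X +
    Polynomial.C (det3 (x • momentPoint r) (y • momentPoint s) c +
      det3 (x • momentPoint r) b (z • momentPoint t) +
      det3 a (y • momentPoint s) (z • momentPoint t)) * Polynomial.X ^ 2 +
    Polynomial.C (x * y * z * ((s - r) * (t - r) * (t - s))) * Polynomial.X ^ 3 with hp
  have hp0 : p ≠ 0 := by
    intro h
    have h3 : p.coeff 3 = x * y * z * ((s - r) * (t - r) * (t - s)) := by
      rw [hp]
      simp only [Polynomial.coeff_add, Polynomial.coeff_C_mul, Polynomial.coeff_X_pow,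
        Polynomial.coeff_X, Polynomial.coeff_C]
      norm_num
    rw [h, Polynomial.coeff_zero] at h3
    have := mul_ne_zero (mul_ne_zero (mul_ne_zero hx hy) hz) (mul_ne_zero (mul_ne_zero
      (sub_ne_zero.2 hrs.symm) (sub_ne_zero.2 hrt.symm)) (sub_ne_zero.2 hst.symm))
    exact this h3.symm
  have hfin : ((p.roots.toFinset : Set ℝ) \ {0}).Finite := (Finset.finite_toSet _).subset
    Set.sdiff_subset
  have hev : ∀ᶠ τ in 𝓝 (0 : ℝ), τ ∉ (p.roots.toFinset : Set ℝ) \ {0} :=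
    hfin.isClosed.isOpen_compl.mem_nhds (by simp)
  filter_upwards [hev.filter_mono nhdsWithin_le_nhds, self_mem_nhdsWithin] with τ h1 h2 h0
  refine h1 ⟨?_, (Set.mem_Ioi.1 h2).ne'⟩
  simp only [Finset.mem_coe, Multiset.mem_toFinset, Polynomial.mem_roots hp0, Polynomial.IsRoot]
  rw [← h0, hp]
  simp [det3, momentPoint]
  ring

/-- Being disjoint (also from antipodes) is an open condition on a pair of arcs. -/
lemma eventually_not_arcsMeet {a b d e : ℝ → Fin 3 → ℝ} (ha : Continuous a) (hb : Continuous b)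
    (hd : Continuous d) (he : Continuous e) (h : ¬ ArcsMeet (a 0) (b 0) (d 0) (e 0)) :
    ∀ᶠ t in 𝓝 (0 : ℝ), ¬ ArcsMeet (a t) (b t) (d t) (e t) := by
  have key : ∀ ε : ℤˣ, ∀ᶠ t in 𝓝 (0 : ℝ), ∀ z ∈ stdSimplex ℝ (Fin 4),
      z 0 • a t + z 1 • b t ≠ ((ε : ℤ) : ℝ) • (z 2 • d t + z 3 • e t) := by
    intro ε
    refine (isCompact_stdSimplex ℝ (Fin 4)).eventually_forall_of_forall_eventually fun z hz => ?_
    have ho : IsOpen {q : ℝ × (Fin 4 → ℝ) | q.2 0 • a q.1 + q.2 1 • b q.1 ≠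
        ((ε : ℤ) : ℝ) • (q.2 2 • d q.1 + q.2 3 • e q.1)} :=
      isOpen_ne_fun (by fun_prop) (by fun_prop)
    exact ho.mem_nhds fun heq => h ⟨z, hz, ε, heq⟩
  filter_upwards [eventually_all.2 key] with t ht hmeet
  obtain ⟨z, hz, ε, heq⟩ := hmeet
  exact ht ε z hz heq

/-- The vectors of an antiperiodic sequence of antiperiod `k`, moved along the moment curve
compatibly with the antiperiodicity; the parameters used are `o, o + 1, …, o + k - 1`. -/
def perturb (k o : ℕ) (u : ℕ → Fin 3 → ℝ) (t : ℝ) (i : ℕ) : Fin 3 → ℝ :=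
  u i + (t * (-1) ^ (i / k)) • momentPoint ((o + i % k : ℕ) : ℝ)

lemma continuous_perturb (k o : ℕ) (u : ℕ → Fin 3 → ℝ) (i : ℕ) :
    Continuous fun t => perturb k o u t i := by
  unfold perturb; fun_prop

lemma perturb_zero (k o : ℕ) (u : ℕ → Fin 3 → ℝ) (i : ℕ) : perturb k o u 0 i = u i := by
  simp [perturb]

lemma perturb_self {k : ℕ} (hk : 0 < k) (o : ℕ) {u : ℕ → Fin 3 → ℝ} (hu : u k = -u 0) (t : ℝ) :
    perturb k o u t k = -perturb k o u t 0 := by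
  simp [perturb, hu, Nat.div_self hk]
  abel

lemma mod_ne_succ_mod {k : ℕ} (hk : 1 < k) (i : ℕ) : i % k ≠ (i + 1) % k := by
  intro h
  have h1 : (k : ℤ) ∣ (i + 1 : ℕ) - (i : ℕ) := (Nat.modEq_iff_dvd).1 h
  have h2 : (k : ℤ) ∣ 1 := by simpa using h1
  have := Int.le_of_dvd one_pos h2
  omega

/-- Two closed polygons in the projective plane, each lifting to a path from a point of the sphere
to its antipode, have a common point. -/
theorem exists_arcsMeet {k m : ℕ} (hk : 1 < k) (hm : 1 < m) {u w : ℕ → Fin 3 → ℝ}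
    (hu : u k = -u 0) (hw : w m = -w 0) :
    ∃ i j, ArcsMeet (u i) (u (i + 1)) (w j) (w (j + 1)) := by
  by_contra! hno
  set U := perturb k 0 u with hU
  set W := perturb m k w with hW
  set n : ℝ → Fin 3 → ℝ := fun t => 0 + (t * 1) • momentPoint ((k + m : ℕ) : ℝ) with hn
  have hs (i : ℕ) : ((-1 : ℝ)) ^ i ≠ 0 := pow_ne_zero _ (by norm_num)
  have hlt (i : ℕ) : i % k < k := Nat.mod_lt _ (by omega)
  have hlt' (j : ℕ) : j % m < m := Nat.mod_lt _ (by omega)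
  have g1 : ∀ i, ∀ᶠ t in 𝓝[>] (0 : ℝ), det3 (n t) (U t i) (U t (i + 1)) ≠ 0 := fun i => by
    have := mod_ne_succ_mod hk i
    have h1 := hlt i
    have h2 := hlt (i + 1)
    refine eventually_det3_ne_zero _ _ _ one_ne_zero (hs _) (hs _) ?_ ?_ ?_ <;>
      rw [Ne, Nat.cast_inj] <;> omega
  have g2 : ∀ i j, ∀ᶠ t in 𝓝[>] (0 : ℝ), det3 (n t) (U t i) (W t j) ≠ 0 := fun i j => by
    have h1 := hlt i
    have h2 := hlt' j
    refine eventually_det3_ne_zero _ _ _ one_ne_zero (hs _) (hs _) ?_ ?_ ?_ <;>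
      rw [Ne, Nat.cast_inj] <;> omega
  have g3 : ∀ i j, ∀ᶠ t in 𝓝[>] (0 : ℝ), det3 (U t i) (U t (i + 1)) (W t j) ≠ 0 := fun i j => by
    have := mod_ne_succ_mod hk i
    have h1 := hlt i
    have h2 := hlt (i + 1)
    have h3 := hlt' j
    refine eventually_det3_ne_zero _ _ _ (hs _) (hs _) (hs _) ?_ ?_ ?_ <;>
      rw [Ne, Nat.cast_inj] <;> omega
  have g4 : ∀ i j, ∀ᶠ t in 𝓝[>] (0 : ℝ), det3 (U t i) (W t j) (W t (j + 1)) ≠ 0 := fun i j => by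
    have := mod_ne_succ_mod hm j
    have h1 := hlt i
    have h2 := hlt' j
    have h3 := hlt' (j + 1)
    refine eventually_det3_ne_zero _ _ _ (hs _) (hs _) (hs _) ?_ ?_ ?_ <;>
      rw [Ne, Nat.cast_inj] <;> omega
  have g5 : ∀ j, ∀ᶠ t in 𝓝[>] (0 : ℝ), det3 (n t) (W t j) (W t (j + 1)) ≠ 0 := fun j => by
    have := mod_ne_succ_mod hm j
    have h2 := hlt' j
    have h3 := hlt' (j + 1)
    refine eventually_det3_ne_zero _ _ _ one_ne_zero (hs _) (hs _) ?_ ?_ ?_ <;>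
      rw [Ne, Nat.cast_inj] <;> omega
  have g6 : ∀ i j, ∀ᶠ t in 𝓝[>] (0 : ℝ),
      ¬ ArcsMeet (U t i) (U t (i + 1)) (W t j) (W t (j + 1)) := fun i j => by
    refine (eventually_not_arcsMeet (continuous_perturb k 0 u i) (continuous_perturb k 0 u (i + 1))
      (continuous_perturb m k w j) (continuous_perturb m k w (j + 1)) ?_).filter_mono
      nhdsWithin_le_nhds
    simpa only [perturb_zero] using hno i j
  have fin1 {P : ℕ → ℝ → Prop} {K : ℕ} (h : ∀ i, ∀ᶠ t in 𝓝[>] (0 : ℝ), P i t) :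
      ∀ᶠ t in 𝓝[>] (0 : ℝ), ∀ i ≤ K, P i t :=
    (Set.finite_Iic K).eventually_all.2 fun i _ => h i
  obtain ⟨t, f1, f2, f3, f4, f5, f6⟩ := ((fin1 (K := k) g1).and
    ((fin1 (K := k) fun i => fin1 (K := m) (g2 i)).and
    ((fin1 (K := k) fun i => fin1 (K := m) (g3 i)).and
    ((fin1 (K := k) fun i => fin1 (K := m) (g4 i)).and
    ((fin1 (K := m) g5).and
    (fin1 (K := k) fun i => fin1 (K := m) (g6 i))))))).exists
  have hsum := sum_crossing_eq_one (u := U t) (w := W t) (n := n t)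
    (perturb_self (by omega) 0 hu t) (perturb_self (by omega) k hw t)
    (fun i hi => f1 i hi.le) f2 (fun i hi => f3 i hi.le) (fun i hi j hj => f4 i hi j hj.le)
    (fun j hj => f5 j hj.le)
  rw [Finset.sum_eq_zero] at hsum
  · exact zero_ne_one hsum
  · intro i hi
    refine Finset.sum_eq_zero fun j hj => ?_
    have hi' := Finset.mem_range.1 hi
    have hj' := Finset.mem_range.1 hj
    by_contra hc
    exact f6 i hi'.le j hj'.le (arcsMeet_of_crossing (f3 i hi'.le j hj'.le)
      (f3 i hi'.le (j + 1) hj') (f4 i hi'.le j hj'.le) (f4 (i + 1) hi' j hj'.le) hc)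

/-! ### Diameter cones at distinct points -/

section Cones

variable {E : Type*} [NormedAddCommGroup E] [InnerProductSpace ℝ E]

lemma two_mul_inner_sub_sub (a x z : E) :
    2 * inner ℝ (a - x) (z - x) = dist x a ^ 2 + dist x z ^ 2 - dist a z ^ 2 := by
  rw [dist_eq_norm, dist_eq_norm, dist_eq_norm, norm_sub_rev x a, norm_sub_rev x z,
    show a - z = (a - x) - (z - x) by abel, norm_sub_sq_real (a - x)]
  ring

/-- A nonnegative combination of directions from `x` to points at distance `D` makes a definite
acute angle with the direction to any point `z` within distance `D` of those points. -/
lemma le_two_mul_inner_cone {D l m : ℝ} {x a b z : E} (hl : 0 ≤ l) (hm : 0 ≤ m)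
    (ha : dist x a = D) (hb : dist x b = D) (haz : dist a z ≤ D) (hbz : dist b z ≤ D) :
    (l + m) * dist x z ^ 2 ≤ 2 * inner ℝ (l • (a - x) + m • (b - x)) (z - x) := by
  have h1 := two_mul_inner_sub_sub a x z
  have h2 := two_mul_inner_sub_sub b x z
  have h3 : dist a z ^ 2 ≤ D ^ 2 := pow_le_pow_left₀ dist_nonneg haz 2
  have h4 : dist b z ^ 2 ≤ D ^ 2 := pow_le_pow_left₀ dist_nonneg hbz 2
  rw [ha] at h1
  rw [hb] at h2
  rw [inner_add_left, real_inner_smul_left, real_inner_smul_left]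
  nlinarith

lemma norm_cone_le {D l m : ℝ} {x a b : E} (hl : 0 ≤ l) (hm : 0 ≤ m)
    (ha : dist x a = D) (hb : dist x b = D) : ‖l • (a - x) + m • (b - x)‖ ≤ (l + m) * D := by
  refine (norm_add_le _ _).trans ?_
  rw [norm_smul, norm_smul, ← dist_eq_norm, ← dist_eq_norm, dist_comm a, dist_comm b, ha, hb,
    Real.norm_of_nonneg hl, Real.norm_of_nonneg hm, add_mul]

/-- The directions of the diameters at `x` point away from those at `y ≠ x`. -/
lemma cone_ne_cone {D l m n r : ℝ} {x a b y c d : E} (hl : 0 ≤ l) (hm : 0 ≤ m) (hn : 0 ≤ n)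
    (hr : 0 ≤ r) (hpos : 0 < l + m + n + r)
    (ha : dist x a = D) (hb : dist x b = D) (hc : dist y c = D) (hd : dist y d = D)
    (hay : dist a y ≤ D) (hby : dist b y ≤ D) (hcx : dist c x ≤ D) (hdx : dist d x ≤ D)
    (hxy : x ≠ y) : l • (a - x) + m • (b - x) ≠ n • (c - y) + r • (d - y) := by
  intro h
  have h1 := le_two_mul_inner_cone hl hm ha hb hay hby
  have h2 := le_two_mul_inner_cone hn hr hc hd hcx hdx
  rw [← h, ← neg_sub y x, inner_neg_right, dist_comm y x] at h2
  have : 0 < dist x y ^ 2 := pow_pos (dist_pos.2 hxy) 2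
  nlinarith

/-- The case of `cone_ne_neg_cone` in which the common vector `p` has length `D`.  Then `x + p` and
`y - p` are within distance `D` of each other, which is only possible if `p = y - x`; and then `y`
would be one of the endpoints `a, b`. -/
lemma cone_ne_neg_cone_of_norm_eq {D l m n r : ℝ} {x a b y c d : E} (hD : 0 < D) (hl : 0 ≤ l)
    (hm : 0 ≤ m) (hn : 0 ≤ n) (hr : 0 ≤ r)
    (ha : dist x a = D) (hb : dist x b = D) (hc : dist y c = D) (hd : dist y d = D)
    (hxy : dist x y ≤ D)
    (hac : dist a c ≤ D) (had : dist a d ≤ D) (hbc : dist b c ≤ D) (hbd : dist b d ≤ D)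
    (hay : a ≠ y) (hby : b ≠ y) (hcx : c ≠ x)
    (hnorm : ‖l • (a - x) + m • (b - x)‖ = D) :
    l • (a - x) + m • (b - x) ≠ -(n • (c - y) + r • (d - y)) := by
  intro h
  set p := l • (a - x) + m • (b - x) with hp
  have hlm : 1 ≤ l + m := by
    have := norm_cone_le hl hm ha hb
    rw [← hp, hnorm] at this
    nlinarith
  have hnr : 1 ≤ n + r := by
    have := norm_cone_le hn hr hc hd
    rw [← norm_neg, ← h, hnorm] at this
    nlinarith
  -- The point `y - p` is within distance `D` of `a` and of `b`.
  have near (e : E) (hec : dist e c ≤ D) (hed : dist e d ≤ D) : dist e (y - p) ≤ D := by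
    have h1 := le_two_mul_inner_cone (z := e) hn hr hc hd (by rwa [dist_comm])
      (by rwa [dist_comm])
    rw [show n • (c - y) + r • (d - y) = -p by rw [h, neg_neg], inner_neg_left,
      dist_comm, dist_eq_norm] at h1
    have h2 : ‖e - (y - p)‖ ^ 2 ≤ D ^ 2 := by
      rw [show e - (y - p) = (e - y) + p by abel, norm_add_sq_real, hnorm, real_inner_comm]
      nlinarith [sq_nonneg ‖e - y‖]
    rw [dist_eq_norm]
    exact le_of_sq_le_sq h2 hD.le
  -- Testing the cone at `x` against that point forces `p = y - x`.
  have h1 := le_two_mul_inner_cone hl hm ha hb (near a hac had) (near b hbc hbd)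
  rw [← hp, dist_comm, dist_eq_norm, show y - p - x = (y - x) - p by abel, inner_sub_right,
    real_inner_self_eq_norm_sq, hnorm] at h1
  have hq : ‖y - x‖ ≤ D := by rwa [← dist_eq_norm, dist_comm]
  have hq2 : ‖y - x‖ ^ 2 ≤ D ^ 2 := pow_le_pow_left₀ (norm_nonneg _) hq 2
  have h2 : ‖y - x - p‖ ^ 2 = ‖y - x‖ ^ 2 - 2 * inner ℝ p (y - x) + D ^ 2 := by
    rw [norm_sub_sq_real, hnorm, real_inner_comm]
  have h3 : ‖y - x - p‖ ^ 2 ≤ 0 := by nlinarith [sq_nonneg ‖y - x - p‖]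
  have h4 : y - x = p := by
    have : ‖y - x - p‖ = 0 := by
      have := sq_nonneg ‖y - x - p‖
      exact pow_eq_zero_iff two_ne_zero |>.1 (le_antisymm h3 this)
    exact sub_eq_zero.1 (norm_eq_zero.1 this)
  have hxyD : dist x y = D := by rw [dist_comm, dist_eq_norm, h4, hnorm]
  -- Testing it against `c` gives `l + m = 1`, so `p` is a proper convex combination of vectors of
  -- its own length.
  have h5 := le_two_mul_inner_cone (z := c) hl hm ha hb hac hbc
  have h6 := two_mul_inner_sub_sub y x c
  rw [← hp, ← h4, h6, hxyD, hc] at h5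
  have hxc : 0 < dist x c ^ 2 := pow_pos (dist_pos.2 hcx.symm) 2
  have h7 := two_mul_inner_sub_sub a x y
  have h8 := two_mul_inner_sub_sub b x y
  rw [ha, hxyD] at h7
  rw [hb, hxyD] at h8
  have h9 : inner ℝ p (y - x) = D ^ 2 := by rw [h4, real_inner_self_eq_norm_sq, hnorm]
  rw [hp, inner_add_left, real_inner_smul_left, real_inner_smul_left] at h9
  have hay2 : 0 < dist a y ^ 2 := pow_pos (dist_pos.2 hay) 2
  have hby2 : 0 < dist b y ^ 2 := pow_pos (dist_pos.2 hby) 2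
  have hle : l + m ≤ 1 := by nlinarith
  have hsum : l * dist a y ^ 2 + m * dist b y ^ 2 ≤ 0 := by nlinarith [sq_nonneg D]
  nlinarith [mul_nonneg hl hay2.le, mul_nonneg hm hby2.le, mul_pos hay2 hby2,
    mul_nonneg hl hby2.le, mul_nonneg hm hay2.le]

/-- The directions of the diameters at `x` and the reversed directions of the diameters at `y`
span disjoint cones, as long as the diameters involved have no endpoint in common. -/
lemma cone_ne_neg_cone {D l m n r : ℝ} {x a b y c d : E} (hD : 0 < D) (hl : 0 ≤ l)
    (hm : 0 ≤ m) (hn : 0 ≤ n) (hr : 0 ≤ r) (hpos : 0 < l + m + n + r)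
    (ha : dist x a = D) (hb : dist x b = D) (hc : dist y c = D) (hd : dist y d = D)
    (hab : dist a b ≤ D) (hcd : dist c d ≤ D) (hxy : dist x y ≤ D)
    (hac : dist a c ≤ D) (had : dist a d ≤ D) (hbc : dist b c ≤ D) (hbd : dist b d ≤ D)
    (hay : a ≠ y) (hby : b ≠ y) (hcx : c ≠ x) :
    l • (a - x) + m • (b - x) ≠ -(n • (c - y) + r • (d - y)) := by
  intro h
  have nonzero {l m : ℝ} {x a b : E} (hl : 0 ≤ l) (hm : 0 ≤ m) (ha : dist x a = D)
      (hb : dist x b = D) (hab : dist a b ≤ D) (hpos : 0 < l + m) :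
      l • (a - x) + m • (b - x) ≠ 0 := by
    intro h0
    have h1 := le_two_mul_inner_cone (z := a) hl hm ha hb (by simpa using hD.le)
      (by rwa [dist_comm])
    rw [h0, inner_zero_left, ha] at h1
    nlinarith [mul_pos hpos (pow_pos hD 2)]
  have hp : l • (a - x) + m • (b - x) ≠ 0 := by
    by_cases hlm : 0 < l + m
    · exact nonzero hl hm ha hb hab hlm
    · rw [h, neg_ne_zero]
      exact nonzero hn hr hc hd hcd (by linarith)
  have hp' := norm_pos_iff.2 hp
  set τ := D / ‖l • (a - x) + m • (b - x)‖ with hτ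
  have hτ0 : 0 < τ := div_pos hD hp'
  have e1 : (τ * l) • (a - x) + (τ * m) • (b - x) = τ • (l • (a - x) + m • (b - x)) := by module
  refine cone_ne_neg_cone_of_norm_eq (l := τ * l) (m := τ * m) (n := τ * n) (r := τ * r) hD
    (by positivity) (by positivity) (by positivity) (by positivity) ha hb hc hd hxy hac had hbc hbd
    hay hby hcx ?_ ?_
  · rw [e1, norm_smul, Real.norm_of_nonneg hτ0.le, hτ, div_mul_cancel₀ _ hp'.ne']
  · rw [e1, h]; module

end Cones

/-- Two odd closed walks along diameters of a set in `ℝ³` have a common vertex.  Taking the edge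
vectors with alternating signs turns an odd closed walk into a polygon joining a point of the sphere
to its antipode, whose arcs are (up to sign) the cones of diameters at the vertices. -/
theorem odd_diameter_walks_meet {f g : ℕ → EuclideanSpace ℝ (Fin 3)} {D : ℝ} {k m : ℕ}
    (hD : 0 < D) (hk : Odd k) (hm : Odd m) (hfk : ∀ i, f (i + k) = f i)
    (hgm : ∀ j, g (j + m) = g j) (hf : ∀ i, dist (f i) (f (i + 1)) = D)
    (hg : ∀ j, dist (g j) (g (j + 1)) = D) (hff : ∀ i j, dist (f i) (f j) ≤ D)
    (hgg : ∀ i j, dist (g i) (g j) ≤ D) (hfg : ∀ i j, dist (f i) (g j) ≤ D) :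
    ∃ i j, f i = g j := by
  by_contra! hne
  have one_lt {f : ℕ → EuclideanSpace ℝ (Fin 3)} {k : ℕ} (hk : Odd k)
      (hfk : ∀ i, f (i + k) = f i) (hf : ∀ i, dist (f i) (f (i + 1)) = D) : 1 < k := by
    have h0 := hk.pos
    by_contra h
    obtain rfl : k = 1 := by omega
    have := hf 0
    rw [hfk 0, dist_self] at this
    exact hD.ne this
  set u : (ℕ → EuclideanSpace ℝ (Fin 3)) → ℕ → Fin 3 → ℝ :=
    fun f i => WithLp.ofLp (((-1 : ℝ) ^ i) • (f (i + 1) - f i)) with hu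
  have anti {f : ℕ → EuclideanSpace ℝ (Fin 3)} {k : ℕ} (hk : Odd k)
      (hfk : ∀ i, f (i + k) = f i) : u f k = -u f 0 := by
    have h1 : f k = f 0 := by simpa using hfk 0
    have h2 : f (k + 1) = f 1 := by rw [add_comm]; exact hfk 1
    simp [hu, h1, h2, hk.neg_one_pow]
  obtain ⟨i, j, z, hz, ε, heq⟩ := exists_arcsMeet (one_lt hk hfk hf) (one_lt hm hgm hg)
    (anti hk hfk) (anti hm hgm)
  have cone (f : ℕ → EuclideanSpace ℝ (Fin 3)) (i : ℕ) (s t : ℝ) :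
      s • u f i + t • u f (i + 1) = ((-1 : ℝ) ^ (i + 1)) • WithLp.ofLp
        (s • (f i - f (i + 1)) + t • (f (i + 2) - f (i + 1))) := by
    ext c
    simp [hu, pow_succ]
    ring
  rw [cone, cone] at heq
  have hsum : 0 < z 0 + z 1 + z 2 + z 3 := by
    have := hz.2
    rw [Fin.sum_univ_four] at this
    linarith
  have hf' (i : ℕ) : dist (f (i + 1)) (f i) = D := by rw [dist_comm, hf]
  have hg' (i : ℕ) : dist (g (i + 1)) (g i) = D := by rw [dist_comm, hg]
  have hgf (i j : ℕ) : dist (g i) (f j) ≤ D := by rw [dist_comm]; exact hfg _ _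
  have c1 := cone_ne_cone (hz.1 0) (hz.1 1) (hz.1 2) (hz.1 3) hsum (hf' i) (hf (i + 1)) (hg' j)
    (hg (j + 1)) (hfg _ _) (hfg _ _) (hgf _ _) (hgf _ _) (hne _ _)
  have c2 := cone_ne_neg_cone hD (hz.1 0) (hz.1 1) (hz.1 2) (hz.1 3) hsum (hf' i) (hf (i + 1))
    (hg' j) (hg (j + 1)) (hff _ _) (hgg _ _) (hfg _ _) (hfg _ _) (hfg _ _) (hfg _ _) (hfg _ _)
    (hne _ _) (hne _ _) (hne _ _).symm
  generalize z 0 • (f i - f (i + 1)) + z 1 • (f (i + 1 + 1) - f (i + 1)) = P at *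
  generalize z 2 • (g j - g (j + 1)) + z 3 • (g (j + 1 + 1) - g (j + 1)) = Q at *
  have hPQ : P = Q ∨ P = -Q := by
    rcases neg_one_pow_eq_or ℝ (i + 1) with h1 | h1 <;>
    rcases neg_one_pow_eq_or ℝ (j + 1) with h2 | h2 <;>
    rcases Int.units_eq_one_or ε with rfl | rfl <;>
    rw [h1, h2] at heq <;>
    first
    | left; ext c; have := congrFun heq c; simp at this; linarith
    | right; ext c; have := congrFun heq c; simp at this ⊢; linarith
  rcases hPQ with h | h
  · exact c1 h
  · exact c2 h

namespace SimpleGraph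

variable {V : Type*} {G : SimpleGraph V}

/-! ### Odd closed walks as periodic sequences -/

/-- `S` induces a bipartite subgraph of `G`: the Boolean `c` is a proper colouring on `S`. -/
def BipartiteOn (G : SimpleGraph V) (S : Finset V) : Prop :=
  ∃ c : V → Bool, ∀ x ∈ S, ∀ y ∈ S, G.Adj x y → c x ≠ c y

/-- A closed walk of length `k` with vertices in `S`, as a `k`-periodic sequence. -/
structure IsPeriodicWalk (G : SimpleGraph V) (S : Finset V) (k : ℕ) (f : ℕ → V) : Prop where
  periodic : Function.Periodic f k
  mem : ∀ i, f i ∈ S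
  adj : ∀ i, G.Adj (f i) (f (i + 1))

lemma isPeriodicWalk_of_closed {S : Finset V} {f : ℕ → V} {a l : ℕ} (hl : 0 < l)
    (hmem : ∀ n < l, f (a + n) ∈ S) (hadj : ∀ n < l, G.Adj (f (a + n)) (f (a + n + 1)))
    (hclosed : f (a + l) = f a) : G.IsPeriodicWalk S l fun n => f (a + n % l) where
  periodic n := by simp
  mem n := hmem _ (Nat.mod_lt _ hl)
  adj n := by
    have h := hadj (n % l) (Nat.mod_lt _ hl)
    rcases (Nat.succ_le_of_lt (Nat.mod_lt n hl)).lt_or_eq with h1 | h1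
    · have : (n + 1) % l = n % l + 1 := by
        rw [Nat.add_mod, Nat.mod_eq_of_lt (show 1 < l by omega), Nat.mod_eq_of_lt h1]
      simpa only [this, add_assoc] using h
    · have h2 : (n + 1) % l = 0 := by
        rw [← Nat.mod_add_mod, ← Nat.succ_eq_add_one, h1, Nat.mod_self]
      have h3 : a + n % l + 1 = a + l := by omega
      simp only [h2, add_zero]
      rwa [h3, hclosed] at h

lemma exists_isPeriodicWalk_of_not_bipartiteOn {S : Finset V} (h : ¬ G.BipartiteOn S) :
    ∃ k, Odd k ∧ ∃ f, G.IsPeriodicWalk S k f := by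
  have h2 : ¬ (G.induce (S : Set V)).Colorable 2 := by
    rintro ⟨C⟩
    classical
    refine h ⟨fun x => if hx : x ∈ S then decide (C ⟨x, hx⟩ = 0) else true,
      fun x hx y hy hxy => ?_⟩
    have := C.valid (v := ⟨x, hx⟩) (w := ⟨y, hy⟩) hxy
    simp only [hx, hy, dif_pos]
    generalize C ⟨x, hx⟩ = p at *
    generalize C ⟨y, hy⟩ = q at *
    revert this
    revert p q
    decide
  rw [two_colorable_iff_forall_loop_even] at h2
  push Not at h2
  obtain ⟨u, w, hw⟩ := h2
  rw [Nat.not_even_iff_odd] at hw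
  refine ⟨w.length, hw, _, isPeriodicWalk_of_closed (f := fun n => (w.getVert n : V)) (a := 0)
    hw.pos (fun n _ => (w.getVert _).2) (fun n hn => ?_) (by simp)⟩
  exact w.adj_getVert_succ (by simpa using hn)

/-- In a set that is not bipartite, a shortest odd closed walk has no repeated vertex. -/
lemma exists_shortest_isPeriodicWalk {S : Finset V} (h : ¬ G.BipartiteOn S) :
    ∃ k, Odd k ∧ ∃ f, G.IsPeriodicWalk S k f ∧ Set.InjOn f (Set.Iio k) := by
  classical
  have hex := exists_isPeriodicWalk_of_not_bipartiteOn h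
  obtain ⟨hodd, f, hf⟩ := Nat.find_spec hex
  set k := Nat.find hex with hk
  replace hodd : Odd k := hodd
  have hmin : ∀ l < k, Odd l → ∀ g, ¬ G.IsPeriodicWalk S l g := fun l hl ho g hg =>
    Nat.find_min hex hl ⟨ho, g, hg⟩
  have hlt : ∀ i j, i < j → j < k → f i ≠ f j := by
    intro i j hij hjk heq
    have h1 : G.IsPeriodicWalk S (j - i) _ := isPeriodicWalk_of_closed (f := f) (a := i)
      (by omega) (fun _ _ => hf.mem _) (fun _ _ => hf.adj _) (by rw [heq]; congr 1; omega)
    have h2 : G.IsPeriodicWalk S (k - (j - i)) _ := isPeriodicWalk_of_closed (f := f) (a := j)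
      (by omega) (fun _ _ => hf.mem _) (fun _ _ => hf.adj _) (by
        rw [← heq, ← hf.periodic i]; congr 1; omega)
    rcases Nat.even_or_odd (j - i) with he | ho
    · exact hmin _ (by omega) (Nat.Odd.sub_even (by omega) hodd he) _ h2
    · exact hmin _ (by omega) ho _ h1
  refine ⟨k, hodd, f, hf, fun i hi j hj heq => ?_⟩
  rcases lt_trichotomy i j with h | h | h
  · exact absurd heq (hlt i j h hj)
  · exact h
  · exact absurd heq.symm (hlt j i h hi)

/-! ### Independent sets in triangle-free graphs -/

lemma isIndepSet_coe_of_forall {s : Finset V} (h : ∀ x ∈ s, ∀ y ∈ s, ¬ G.Adj x y) :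
    G.IsIndepSet (s : Set V) := fun x hx y hy _ => h x hx y hy

lemma IsIndepSet.not_adj {s : Set V} (h : G.IsIndepSet s) {x y : V} (hx : x ∈ s) (hy : y ∈ s) :
    ¬ G.Adj x y := fun hxy => h hx hy hxy.ne hxy

lemma IsIndepSet.insert_of_forall {s : Set V} (h : G.IsIndepSet s) {x : V}
    (hx : ∀ y ∈ s, ¬ G.Adj x y) : G.IsIndepSet (insert x s) := by
  rintro a (rfl | ha) b (rfl | hb) hab
  · exact absurd rfl hab
  · exact hx b hb
  · exact fun h' => hx a ha h'.symm
  · exact h ha hb hab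

/-- `G` has no triangle. -/
def TriangleFree (G : SimpleGraph V) : Prop :=
  ∀ a b c, G.Adj a b → G.Adj b c → G.Adj c a → False

lemma exists_not_adj_of_three_le_card (ht : G.TriangleFree) {R : Finset V} (hR : 3 ≤ R.card) :
    ∃ x ∈ R, ∃ y ∈ R, x ≠ y ∧ ¬ G.Adj x y := by
  obtain ⟨a, b, c, ha, hb, hc, hab, hac, hbc⟩ := Finset.two_lt_card_iff.1 hR
  by_contra! h
  exact ht a b c (h a ha b hb hab) (h b hb c hc hbc) (h c hc a ha hac.symm)

lemma BipartiteOn.exists_indep_split {S : Finset V} (h : G.BipartiteOn S) :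
    ∃ A B : Finset V, G.IsIndepSet (A : Set V) ∧ G.IsIndepSet (B : Set V) ∧ A ⊆ S ∧ B ⊆ S ∧
      Disjoint A B ∧ A.card + B.card = S.card := by
  obtain ⟨c, hc⟩ := h
  refine ⟨{x ∈ S | c x = true}, {x ∈ S | ¬ c x = true},
    isIndepSet_coe_of_forall fun x hx y hy hxy => ?_,
    isIndepSet_coe_of_forall fun x hx y hy hxy => ?_, Finset.filter_subset _ _,
    Finset.filter_subset _ _, Finset.disjoint_filter_filter_not _ _ _,
    Finset.card_filter_add_card_filter_not _⟩ <;>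
  · rw [Finset.mem_filter] at hx hy
    exact hc x hx.1 y hy.1 hxy (by grind)

lemma bool_false_of_three_ne : ∀ x y z : Bool, x ≠ y → y ≠ z → z ≠ x → False := by decide

lemma bool_false_of_five_ne : ∀ x y z u w : Bool, x ≠ y → y ≠ z → z ≠ u → u ≠ w → w ≠ x →
    False := by
  rintro (_ | _) (_ | _) (_ | _) (_ | _) (_ | _) <;> simp

lemma not_bipartiteOn_triangle [DecidableEq V] {a b c : V} (hab : G.Adj a b) (hbc : G.Adj b c)
    (hca : G.Adj c a) : ¬ G.BipartiteOn {a, b, c} := by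
  rintro ⟨f, hf⟩
  have h1 := hf a (by simp) b (by simp) hab
  have h2 := hf b (by simp) c (by simp) hbc
  have h3 := hf c (by simp) a (by simp) hca
  exact bool_false_of_three_ne _ _ _ h1 h2 h3

lemma not_bipartiteOn_pentagon [DecidableEq V] {a b c d e : V} (hab : G.Adj a b)
    (hbc : G.Adj b c) (hcd : G.Adj c d) (hde : G.Adj d e) (hea : G.Adj e a) :
    ¬ G.BipartiteOn {a, b, c, d, e} := by
  rintro ⟨f, hf⟩
  have h1 := hf a (by simp) b (by simp) hab
  have h2 := hf b (by simp) c (by simp) hbc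
  have h3 := hf c (by simp) d (by simp) hcd
  have h4 := hf d (by simp) e (by simp) hde
  have h5 := hf e (by simp) a (by simp) hea
  exact bool_false_of_five_ne _ _ _ _ _ h1 h2 h3 h4 h5

lemma TriangleFree.isIndepSet_neighborFinset [Fintype V] [DecidableRel G.Adj]
    (ht : G.TriangleFree) (v : V) : G.IsIndepSet (G.neighborFinset v : Set V) :=
  isIndepSet_coe_of_forall fun x hx y hy hxy => by
    rw [mem_neighborFinset] at hx hy
    exact ht v x y hx hxy hy.symm

/-- The greedy bound, improved by one thanks to triangle-freeness: it ends with three vertices, two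
of which are not adjacent. -/
lemma exists_isIndepSet_of_degree_le_two [Fintype V] [DecidableEq V] [DecidableRel G.Adj]
    (ht : G.TriangleFree) (hdeg : ∀ v, G.degree v ≤ 2) (t : ℕ) (R : Finset V)
    (hR : 3 * (t + 1) ≤ R.card) : ∃ s ⊆ R, G.IsIndepSet (s : Set V) ∧ s.card = t + 2 := by
  induction t generalizing R with
  | zero =>
    obtain ⟨x, hx, y, hy, hxy, hn⟩ := exists_not_adj_of_three_le_card ht (R := R) (by omega)
    refine ⟨{x, y}, by grind, isIndepSet_coe_of_forall ?_, by rw [Finset.card_pair hxy]⟩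
    intro a ha b hb hab
    have := hab.ne
    have := hab.symm
    grind
  | succ t ih =>
    obtain ⟨v, hv⟩ := Finset.card_pos.1 (show 0 < R.card by omega)
    have h1 : (insert v (G.neighborFinset v)).card ≤ 3 :=
      (Finset.card_insert_le _ _).trans
        (by rw [card_neighborFinset_eq_degree]; have := hdeg v; omega)
    have h2 := Finset.le_card_sdiff (insert v (G.neighborFinset v)) R
    obtain ⟨s, hs, hind, hcard⟩ := ih (R \ insert v (G.neighborFinset v)) (by omega)
    have hvs : v ∉ s := fun h => by simpa using hs h
    refine ⟨insert v s, Finset.insert_subset hv (hs.trans Finset.sdiff_subset), ?_, ?_⟩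
    · rw [Finset.coe_insert]
      refine hind.insert_of_forall fun y hy hvy => ?_
      have := hs hy
      simp [hvy] at this
    · rw [Finset.card_insert_of_notMem hvs, hcard]

/-! ### Graphs without disjoint odd cycles and without large independent sets -/

/-- Of any two disjoint vertex sets one induces a bipartite graph; equivalently, any two odd
cycles have a common vertex. -/
def OddCyclesMeet (G : SimpleGraph V) : Prop :=
  ∀ S T : Finset V, Disjoint S T → G.BipartiteOn S ∨ G.BipartiteOn T

/-- All independent sets have at most four vertices. -/
def IndepLeFour (G : SimpleGraph V) : Prop :=
  ∀ s : Finset V, G.IsIndepSet (s : Set V) → s.card ≤ 4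

lemma IndepLeFour.length_le [DecidableEq V] (hα : G.IndepLeFour) {l : List V} (hl : l.Nodup)
    (h : l.Pairwise fun x y => ¬ G.Adj x y) : l.length ≤ 4 := by
  rw [← List.toFinset_card_of_nodup hl]
  refine hα _ fun x hx y hy hxy => ?_
  rw [Finset.mem_coe, List.mem_toFinset] at hx hy
  have : Std.Symm fun x y => ¬ G.Adj x y := ⟨fun _ _ h h' => h h'.symm⟩
  exact h.forall hx hy hxy

lemma OddCyclesMeet.bipartiteOn_compl [Fintype V] [DecidableEq V] (ho : G.OddCyclesMeet)
    {S : Finset V} (hS : ¬ G.BipartiteOn S) : G.BipartiteOn Sᶜ :=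
  (ho S Sᶜ disjoint_compl_right).resolve_left hS

lemma triangleFree_of_indepLeFour [Fintype V] [DecidableEq V] (hV : Fintype.card V = 12)
    (ho : G.OddCyclesMeet) (hα : G.IndepLeFour) : G.TriangleFree := by
  intro a b c hab hbc hca
  obtain ⟨A, B, hA, hB, -, -, -, hcard⟩ :=
    (ho.bipartiteOn_compl (not_bipartiteOn_triangle hab hbc hca)).exists_indep_split
  have h1 := hα A hA
  have h2 := hα B hB
  have h3 : ({a, b, c} : Finset V).card ≤ 3 := Finset.card_le_three
  rw [Finset.card_compl, hV] at hcard
  omega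

/-- A vertex outside an independent set of the maximal size four has a neighbour in it. -/
lemma IndepLeFour.exists_adj [DecidableEq V] (hα : G.IndepLeFour) {A : Finset V}
    (hA : G.IsIndepSet (A : Set V)) (hA4 : 4 ≤ A.card) {x : V} (hx : x ∉ A) :
    ∃ a ∈ A, G.Adj x a := by
  by_contra! h
  have h1 := hα (insert x A) (by rw [Finset.coe_insert]; exact hA.insert_of_forall h)
  rw [Finset.card_insert_of_notMem hx] at h1
  omega

lemma pentagon_false_of_indep_split [Fintype V] [DecidableEq V] [DecidableRel G.Adj]
    (hα : G.IndepLeFour) (ht : G.TriangleFree) (hdeg : ∀ v, G.degree v ≤ 3) {a b c d e : V}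
    (hab : G.Adj a b) (hbc : G.Adj b c) (hcd : G.Adj c d) (hde : G.Adj d e) (hea : G.Adj e a)
    {A B : Finset V} (hA : G.IsIndepSet (A : Set V)) (hB : G.IsIndepSet (B : Set V))
    (hAS : A ⊆ ({a, b, c, d, e} : Finset V)ᶜ) (hBS : B ⊆ ({a, b, c, d, e} : Finset V)ᶜ)
    (hAB : Disjoint A B) (hA4 : 4 ≤ A.card) (hB3 : 3 ≤ B.card) : False := by
  have hAn : ∀ x ∈ ({a, b, c, d, e} : Finset V), x ∉ A := fun x hx hxA =>
    Finset.mem_compl.1 (hAS hxA) hx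
  have hBn : ∀ x ∈ ({a, b, c, d, e} : Finset V), x ∉ B := fun x hx hxB =>
    Finset.mem_compl.1 (hBS hxB) hx
  have key : ∀ x ∈ ({a, b, c, d, e} : Finset V), ∀ y ∈ ({a, b, c, d, e} : Finset V),
      ∀ z ∈ ({a, b, c, d, e} : Finset V), y ≠ z → G.Adj x y → G.Adj x z →
      ∀ β ∈ B, ¬ G.Adj x β := by
    intro x hx y hy z hz hyz hxy hxz β hβ hxβ
    obtain ⟨α, hα, hxα⟩ := hα.exists_adj hA hA4 (hAn x hx)
    have hsub : ({y, z, α, β} : Finset V) ⊆ G.neighborFinset x := by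
      intro w hw
      simp only [Finset.mem_insert, Finset.mem_singleton] at hw
      rw [mem_neighborFinset]
      rcases hw with rfl | rfl | rfl | rfl <;> assumption
    have hcard : ({y, z, α, β} : Finset V).card = 4 := by
      have h1 : y ≠ α := fun h => hAn y hy (h ▸ hα)
      have h2 : z ≠ α := fun h => hAn z hz (h ▸ hα)
      have h3 : y ≠ β := fun h => hBn y hy (h ▸ hβ)
      have h4 : z ≠ β := fun h => hBn z hz (h ▸ hβ)
      have h5 : α ≠ β := fun h => Finset.disjoint_left.1 hAB hα (h ▸ hβ)
      rw [Finset.card_insert_of_notMem (by simp [hyz, h1, h3]),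
        Finset.card_insert_of_notMem (by simp [h2, h4]), Finset.card_pair h5]
    have := Finset.card_le_card hsub
    rw [hcard, card_neighborFinset_eq_degree] at this
    have := hdeg x
    omega
  have hac : a ≠ c := by rintro rfl; exact ht a d e hcd hde hea
  have hbe : b ≠ e := by rintro rfl; exact ht b c d hbc hcd hde
  have hbd : b ≠ d := by rintro rfl; exact ht a b e hab hde hea
  have hnac : ¬ G.Adj a c := fun h => ht a b c hab hbc h.symm
  have ha := key a (by simp) b (by simp) e (by simp) hbe hab hea.symm
  have hc := key c (by simp) b (by simp) d (by simp) hbd hbc.symm hcd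
  have hind : G.IsIndepSet ((insert a (insert c B) : Finset V) : Set V) := by
    rw [Finset.coe_insert, Finset.coe_insert]
    refine (hB.insert_of_forall hc).insert_of_forall ?_
    rintro y (rfl | hy)
    · exact hnac
    · exact ha y hy
  have := hα _ hind
  rw [Finset.card_insert_of_notMem (by simp [hac, hBn a (by simp)]),
    Finset.card_insert_of_notMem (hBn c (by simp))] at this
  omega

/-- With all degrees at most three there is no pentagon: off the pentagon there are disjoint
independent sets `A` of size four and `B` of size three.  Each pentagon vertex has a neighbour in
`A` by maximality, so none in `B`, and two nonadjacent pentagon vertices can be added to `B`. -/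
lemma pentagon_false_of_degree_le_three [Fintype V] [DecidableEq V] [DecidableRel G.Adj]
    (hV : Fintype.card V = 12) (ho : G.OddCyclesMeet) (hα : G.IndepLeFour) (ht : G.TriangleFree)
    (hdeg : ∀ v, G.degree v ≤ 3) {a b c d e : V} (hab : G.Adj a b) (hbc : G.Adj b c)
    (hcd : G.Adj c d) (hde : G.Adj d e) (hea : G.Adj e a) : False := by
  obtain ⟨A, B, hA, hB, hAS, hBS, hAB, hcard⟩ := (ho.bipartiteOn_compl
    (not_bipartiteOn_pentagon hab hbc hcd hde hea)).exists_indep_split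
  have h1 := hα A hA
  have h2 := hα B hB
  have h3 : ({a, b, c, d, e} : Finset V).card ≤ 5 := Finset.card_le_five
  rw [Finset.card_compl, hV] at hcard
  rcases le_or_gt 4 A.card with h4 | h4
  · exact pentagon_false_of_indep_split hα ht hdeg hab hbc hcd hde hea hA hB hAS hBS hAB h4
      (by omega)
  · exact pentagon_false_of_indep_split hα ht hdeg hab hbc hcd hde hea hB hA hBS hAS hAB.symm
      (by omega) (by omega)

/-- A vertex of degree three lies near a pentagon: otherwise its second neighbourhood is
independent, hence has at most three vertices, and two nonadjacent ones among the five or more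
remaining vertices extend its neighbourhood to an independent set. -/
lemma exists_pentagon_of_degree_eq_three [Fintype V] [DecidableEq V] [DecidableRel G.Adj]
    (hV : Fintype.card V = 12) (hα : G.IndepLeFour) (ht : G.TriangleFree) {v : V}
    (hv : G.degree v = 3) : ∃ a b c d e : V, G.Adj a b ∧ G.Adj b c ∧ G.Adj c d ∧ G.Adj d e ∧
      G.Adj e a := by
  by_contra hno
  set N := G.neighborFinset v with hN
  have hNcard : N.card = 3 := by rw [hN, card_neighborFinset_eq_degree, hv]
  set M : Finset V := {y | y ≠ v ∧ ∃ a, G.Adj v a ∧ G.Adj a y} with hM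
  have hMind : G.IsIndepSet (M : Set V) := isIndepSet_coe_of_forall fun y hy z hz hyz => by
    simp only [hM, Finset.mem_filter, Finset.mem_univ, true_and] at hy hz
    obtain ⟨-, a, hva, hay⟩ := hy
    obtain ⟨-, b, hvb, hbz⟩ := hz
    exact hno ⟨v, a, y, z, b, hva, hay, hyz, hbz.symm, hvb.symm⟩
  have hvM : ∀ y ∈ M, ¬ G.Adj v y := by
    intro y hy hvy
    simp only [hM, Finset.mem_filter, Finset.mem_univ, true_and] at hy
    obtain ⟨-, a, hva, hay⟩ := hy
    exact ht v a y hva hay hvy.symm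
  have hMcard : M.card ≤ 3 := by
    have h1 := hα (insert v M) (by rw [Finset.coe_insert]; exact hMind.insert_of_forall hvM)
    rw [Finset.card_insert_of_notMem (by simp [hM])] at h1
    omega
  have hR : 3 ≤ ((insert v (N ∪ M))ᶜ).card := by
    have h1 := Finset.card_insert_le v (N ∪ M)
    have h2 := Finset.card_union_le N M
    rw [Finset.card_compl, hV]
    omega
  obtain ⟨x, hx, y, hy, hxy, hnxy⟩ := exists_not_adj_of_three_le_card ht hR
  have far : ∀ x ∈ (insert v (N ∪ M))ᶜ, ∀ a ∈ N, ¬ G.Adj x a := by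
    intro x hx a ha hxa
    simp only [Finset.mem_compl, Finset.mem_insert, Finset.mem_union, hN, hM, mem_neighborFinset,
      Finset.mem_filter, Finset.mem_univ, true_and] at hx ha
    exact hx (by by_cases h : x = v; exacts [Or.inl h, Or.inr (Or.inr ⟨h, a, ha, hxa.symm⟩)])
  have hind : G.IsIndepSet ((insert x (insert y N) : Finset V) : Set V) := by
    rw [Finset.coe_insert, Finset.coe_insert]
    refine ((ht.isIndepSet_neighborFinset v).insert_of_forall (far y hy)).insert_of_forall ?_
    rintro z (rfl | hz)
    · exact hnxy
    · exact far x hx z hz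
  have hcard := hα _ hind
  have hxN : x ∉ N := fun h => by simp [h] at hx
  have hyN : y ∉ N := fun h => by simp [h] at hy
  rw [Finset.card_insert_of_notMem (by simp [hxy, hxN]), Finset.card_insert_of_notMem hyN] at hcard
  omega

/-! ### Vertices of degree four -/

/-- A pentagon `c₀c₁c₂c₃c₄` and two further vertices `r, s`, all of them distinct from and not
adjacent to `v`. -/
structure PentagonPair (G : SimpleGraph V) (v c₀ c₁ c₂ c₃ c₄ r s : V) : Prop where
  adj₀ : G.Adj c₀ c₁
  adj₁ : G.Adj c₁ c₂
  adj₂ : G.Adj c₂ c₃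
  adj₃ : G.Adj c₃ c₄
  adj₄ : G.Adj c₄ c₀
  not_adj : ∀ x ∈ [c₀, c₁, c₂, c₃, c₄, r, s], ¬ G.Adj v x
  nodup : [v, c₀, c₁, c₂, c₃, c₄, r, s].Nodup

namespace PentagonPair

variable {v c₀ c₁ c₂ c₃ c₄ r s : V}

lemma rotate (h : G.PentagonPair v c₀ c₁ c₂ c₃ c₄ r s) : G.PentagonPair v c₁ c₂ c₃ c₄ c₀ r s :=
  ⟨h.adj₁, h.adj₂, h.adj₃, h.adj₄, h.adj₀, by have := h.not_adj; grind, by have := h.nodup; grind⟩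

lemma symm (h : G.PentagonPair v c₀ c₁ c₂ c₃ c₄ r s) : G.PentagonPair v c₀ c₁ c₂ c₃ c₄ s r :=
  ⟨h.adj₀, h.adj₁, h.adj₂, h.adj₃, h.adj₄, by have := h.not_adj; grind, by have := h.nodup; grind⟩

/-- Exchanging `c₁` with a vertex `r` adjacent to both of its neighbours on the pentagon. -/
lemma exchange (h : G.PentagonPair v c₀ c₁ c₂ c₃ c₄ r s) (h₀ : G.Adj r c₀) (h₂ : G.Adj r c₂) :
    G.PentagonPair v c₀ r c₂ c₃ c₄ c₁ s :=
  ⟨h₀.symm, h₂, h.adj₂, h.adj₃, h.adj₄, by have := h.not_adj; grind, by have := h.nodup; grind⟩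

variable [Fintype V] [DecidableEq V] [DecidableRel G.Adj]

/-- Both `r` and `s` have neighbours in the neighbourhood of `v`, so an edge `rs` would close an
odd walk disjoint from the pentagon. -/
lemma not_adj_pair (h : G.PentagonPair v c₀ c₁ c₂ c₃ c₄ r s) (ho : G.OddCyclesMeet)
    (hα : G.IndepLeFour) (ht : G.TriangleFree) (hv : G.degree v = 4) : ¬ G.Adj r s := by
  intro hrs
  have hnbr : ∀ x ∈ [c₀, c₁, c₂, c₃, c₄, r, s], ∃ w, G.Adj v w ∧ G.Adj x w := by
    intro x hx
    obtain ⟨w, hw, hxw⟩ := hα.exists_adj (ht.isIndepSet_neighborFinset v)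
      (by rw [card_neighborFinset_eq_degree, hv]) (x := x)
      (by rw [mem_neighborFinset]; exact h.not_adj x hx)
    exact ⟨w, by rwa [mem_neighborFinset] at hw, hxw⟩
  obtain ⟨w, hvw, hrw⟩ := hnbr r (by simp)
  obtain ⟨u, hvu, hsu⟩ := hnbr s (by simp)
  have hn := h.nodup
  have ha := h.not_adj
  obtain ⟨f, hf⟩ := ho.bipartiteOn_compl
    (not_bipartiteOn_pentagon h.adj₀ h.adj₁ h.adj₂ h.adj₃ h.adj₄)
  simp only [List.mem_cons, List.not_mem_nil, or_false, forall_eq_or_imp, forall_eq] at ha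
  obtain ⟨a0, a1, a2, a3, a4, -, -⟩ := ha
  have off {x : V} (hx : G.Adj v x) : x ∈ ({c₀, c₁, c₂, c₃, c₄} : Finset V)ᶜ := by
    simp only [Finset.mem_compl, Finset.mem_insert, Finset.mem_singleton]
    rintro (rfl | rfl | rfl | rfl | rfl) <;> contradiction
  simp only [List.nodup_cons, List.mem_cons, List.not_mem_nil, or_false, not_or] at hn
  have hvS : v ∈ ({c₀, c₁, c₂, c₃, c₄} : Finset V)ᶜ := by simp [hn]
  have hrS : r ∈ ({c₀, c₁, c₂, c₃, c₄} : Finset V)ᶜ := by simp; grind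
  have hsS : s ∈ ({c₀, c₁, c₂, c₃, c₄} : Finset V)ᶜ := by simp; grind
  have h1 := hf v hvS w (off hvw) hvw
  have h2 := hf v hvS u (off hvu) hvu
  have h3 := hf r hrS w (off hvw) hrw
  have h4 := hf s hsS u (off hvu) hsu
  have h5 := hf r hrS s hsS hrs
  exact bool_false_of_five_ne _ _ _ _ _ h1 h3.symm h5 h4 h2.symm

lemma adj_or_adj (h : G.PentagonPair v c₀ c₁ c₂ c₃ c₄ r s) (ho : G.OddCyclesMeet)
    (hα : G.IndepLeFour) (ht : G.TriangleFree) (hv : G.degree v = 4) :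
    G.Adj r c₀ ∨ G.Adj r c₂ ∨ G.Adj s c₀ ∨ G.Adj s c₂ := by
  by_contra! hno
  have hrs := h.not_adj_pair ho hα ht hv
  have h02 : ¬ G.Adj c₀ c₂ := fun h' => ht _ _ _ h.adj₀ h.adj₁ h'.symm
  have hn := h.nodup
  have ha := h.not_adj
  simp only [List.nodup_cons, List.mem_cons, List.not_mem_nil, or_false, not_or] at hn
  simp only [List.mem_cons, List.not_mem_nil, or_false, forall_eq_or_imp, forall_eq] at ha
  obtain ⟨a0, -, a2, -, -, ar, as⟩ := ha
  obtain ⟨n1, n2, n3⟩ := hno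
  have := hα.length_le (l := [v, r, s, c₀, c₂])
    (by simp only [List.nodup_cons, List.mem_cons, List.not_mem_nil, or_false, not_or]; grind)
    (by
      simp only [List.pairwise_cons, List.mem_cons, List.not_mem_nil, or_false, forall_eq_or_imp,
        forall_eq]
      simp [*])
  simp at this

/-- If `r` is adjacent to `c₀` and `c₂`, then after exchanging `c₁` with `r` the vertex `s` is seen
to be adjacent to both `c₃` and `c₄`. -/
lemma not_adj_and_adj (h : G.PentagonPair v c₀ c₁ c₂ c₃ c₄ r s) (ho : G.OddCyclesMeet)
    (hα : G.IndepLeFour) (ht : G.TriangleFree) (hv : G.degree v = 4) :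
    ¬ (G.Adj r c₀ ∧ G.Adj r c₂) := by
  rintro ⟨h₀, h₂⟩
  have h1s : ¬ G.Adj s c₁ := fun hs => (h.exchange h₀ h₂).not_adj_pair ho hα ht hv hs.symm
  have hr1 : ¬ G.Adj r c₁ := fun hr => ht _ _ _ h₀ h.adj₀ hr.symm
  have hr3 : ¬ G.Adj r c₃ := fun hr => ht _ _ _ h₂ h.adj₂ hr.symm
  have hr4 : ¬ G.Adj r c₄ := fun hr => ht _ _ _ hr h.adj₄ h₀.symm
  have h13 := h.rotate.adj_or_adj ho hα ht hv
  have h41 := h.rotate.rotate.rotate.rotate.adj_or_adj ho hα ht hv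
  have hs3 : G.Adj s c₃ := by tauto
  have hs4 : G.Adj s c₄ := by tauto
  exact ht _ _ _ hs3 h.adj₃ hs4.symm

/-- The neighbours of `r` and `s` meet every pair of nonadjacent pentagon vertices, but each of `r`
and `s` has at most one neighbour on the pentagon. -/
lemma false_of_degree_eq_four (h : G.PentagonPair v c₀ c₁ c₂ c₃ c₄ r s) (ho : G.OddCyclesMeet)
    (hα : G.IndepLeFour) (ht : G.TriangleFree) (hv : G.degree v = 4) : False := by
  have h1 := h.rotate
  have h2 := h1.rotate
  have h3 := h2.rotate
  have h4 := h3.rotate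
  have p0 := h.adj_or_adj ho hα ht hv
  have p1 := h1.adj_or_adj ho hα ht hv
  have p2 := h2.adj_or_adj ho hα ht hv
  have p3 := h3.adj_or_adj ho hα ht hv
  have p4 := h4.adj_or_adj ho hα ht hv
  have q0 := h.not_adj_and_adj ho hα ht hv
  have q1 := h1.not_adj_and_adj ho hα ht hv
  have q2 := h2.not_adj_and_adj ho hα ht hv
  have q3 := h3.not_adj_and_adj ho hα ht hv
  have q4 := h4.not_adj_and_adj ho hα ht hv
  have t0 := h.symm.not_adj_and_adj ho hα ht hv
  have t1 := h1.symm.not_adj_and_adj ho hα ht hv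
  have t2 := h2.symm.not_adj_and_adj ho hα ht hv
  have t3 := h3.symm.not_adj_and_adj ho hα ht hv
  have t4 := h4.symm.not_adj_and_adj ho hα ht hv
  have edge (x y z : V) (hyz : G.Adj y z) : ¬ (G.Adj x y ∧ G.Adj x z) := fun hx =>
    ht _ _ _ hx.1 hyz hx.2.symm
  have u0 := edge r _ _ h.adj₀
  have u1 := edge r _ _ h.adj₁
  have u2 := edge r _ _ h.adj₂
  have u3 := edge r _ _ h.adj₃
  have u4 := edge r _ _ h.adj₄
  have w0 := edge s _ _ h.adj₀
  have w1 := edge s _ _ h.adj₁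
  have w2 := edge s _ _ h.adj₂
  have w3 := edge s _ _ h.adj₃
  have w4 := edge s _ _ h.adj₄
  clear edge h h1 h2 h3 h4
  generalize G.Adj r c₀ = r0 at *
  generalize G.Adj r c₁ = r1 at *
  generalize G.Adj r c₂ = r2 at *
  generalize G.Adj r c₃ = r3 at *
  generalize G.Adj r c₄ = r4 at *
  grind

end PentagonPair

set_option maxRecDepth 10000 in
/-- Every set of pairwise nonconsecutive vertices of a heptagon is disjoint from at least two of
the seven independent triples `{i, i + 2, i + 4}`. -/
lemma two_le_card_heptagon_triples : ∀ T : Finset (Fin 7), (∀ i, ¬ (i ∈ T ∧ i + 1 ∈ T)) →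
    2 ≤ (Finset.univ.filter fun i => i ∉ T ∧ i + 2 ∉ T ∧ i + 4 ∉ T).card := by
  decide

/-- An induced heptagon without neighbours of `v` cannot coexist with four neighbours of `v`: each
independent triple of the heptagon is avoided by at most one neighbour of `v`, while each neighbour
of `v` avoids at least two of the seven triples. -/
lemma heptagon_false_of_degree_eq_four [Fintype V] [DecidableEq V] [DecidableRel G.Adj]
    (hα : G.IndepLeFour) (ht : G.TriangleFree) {v : V} (hv : G.degree v = 4) {F : Fin 7 → V}
    (hinj : Function.Injective F) (hadj : ∀ i, G.Adj (F i) (F (i + 1)))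
    (hchord : ∀ i, ¬ G.Adj (F i) (F (i + 4))) (hFv : ∀ i, ¬ G.Adj v (F i)) : False := by
  have hchord2 (i : Fin 7) : ¬ G.Adj (F i) (F (i + 2)) := fun h =>
    ht _ _ _ (hadj i) (by simpa [add_assoc] using hadj (i + 1)) h.symm
  set M : V → Finset (Fin 7) := fun w => Finset.univ.filter fun i =>
    ¬ G.Adj w (F i) ∧ ¬ G.Adj w (F (i + 2)) ∧ ¬ G.Adj w (F (i + 4)) with hM
  have hM2 : ∀ w, 2 ≤ (M w).card := by
    intro w
    have := two_le_card_heptagon_triples (Finset.univ.filter fun i => G.Adj w (F i)) (by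
      intro i hi
      simp only [Finset.mem_filter, Finset.mem_univ, true_and] at hi
      exact ht _ _ _ hi.1 (hadj i) hi.2.symm)
    simpa [hM] using this
  have hdisj : Set.PairwiseDisjoint (G.neighborFinset v : Set V) M := by
    intro w hw u hu hwu
    rw [Function.onFun, Finset.disjoint_left]
    intro i hi hi'
    simp only [hM, Finset.mem_filter, Finset.mem_univ, true_and] at hi hi'
    have hwu' : ¬ G.Adj w u := (ht.isIndepSet_neighborFinset v).not_adj hw hu
    rw [Finset.mem_coe, mem_neighborFinset] at hw hu
    have hne (x : V) (hx : G.Adj v x) (j : Fin 7) : x ≠ F j := fun h => hFv j (h ▸ hx)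
    have h24 : ¬ G.Adj (F (i + 2)) (F (i + 4)) := by
      have := hchord2 (i + 2)
      rwa [show i + 2 + 2 = i + 4 by rw [add_assoc]; rfl] at this
    have h02 := hchord2 i
    have h04 := hchord i
    have e1 : i ≠ i + 2 := (by decide : ∀ i : Fin 7, i ≠ i + 2) i
    have e2 : i ≠ i + 4 := (by decide : ∀ i : Fin 7, i ≠ i + 4) i
    have e3 : i + 2 ≠ i + 4 := (by decide : ∀ i : Fin 7, i + 2 ≠ i + 4) i
    have := hα.length_le (l := [w, u, F i, F (i + 2), F (i + 4)])
      (by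
        simp only [List.nodup_cons, List.mem_cons, List.not_mem_nil, or_false, not_or]
        have := hne w hw
        have := hne u hu
        have := hinj.ne e1
        have := hinj.ne e2
        have := hinj.ne e3
        simp_all only [ne_eq, not_false_eq_true, and_self, List.nodup_nil])
      (by
        simp only [List.pairwise_cons, List.mem_cons, List.not_mem_nil, or_false, forall_eq_or_imp,
          forall_eq]
        simp [*])
    simp at this
  have h1 : (G.neighborFinset v).card * 2 ≤ ∑ w ∈ G.neighborFinset v, (M w).card := by
    rw [← smul_eq_mul]
    exact Finset.card_nsmul_le_sum _ _ _ fun w _ => hM2 w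
  rw [← Finset.card_biUnion hdisj, card_neighborFinset_eq_degree, hv] at h1
  have h2 := Finset.card_le_univ ((G.neighborFinset v).biUnion M)
  rw [Fintype.card_fin] at h2
  omega

/-- A nonbipartite set of at most seven vertices contains a pentagon or an induced heptagon. -/
lemma exists_pentagon_or_heptagon (ht : G.TriangleFree) {H : Finset V} (hH : H.card ≤ 7)
    (hb : ¬ G.BipartiteOn H) :
    (∃ c₀ ∈ H, ∃ c₁ ∈ H, ∃ c₂ ∈ H, ∃ c₃ ∈ H, ∃ c₄ ∈ H, G.Adj c₀ c₁ ∧ G.Adj c₁ c₂ ∧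
      G.Adj c₂ c₃ ∧ G.Adj c₃ c₄ ∧ G.Adj c₄ c₀) ∨
    ∃ F : Fin 7 → V, Function.Injective F ∧ (∀ i, F i ∈ H) ∧ (∀ i, G.Adj (F i) (F (i + 1))) ∧
      ∀ i, ¬ G.Adj (F i) (F (i + 4)) := by
  rw [or_iff_not_imp_left]
  intro hno
  obtain ⟨k, hk, f, hf, hinj⟩ := exists_shortest_isPeriodicWalk hb
  have hk7 : k ≤ 7 := by
    classical
    have h1 : ((Finset.range k).image f).card = k := by
      rw [Finset.card_image_of_injOn (by simpa using hinj), Finset.card_range]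
    have h2 : (Finset.range k).image f ⊆ H := Finset.image_subset_iff.2 fun i _ => hf.mem i
    have := Finset.card_le_card h2
    omega
  have hk' : k = 1 ∨ k = 3 ∨ k = 5 ∨ k = 7 := by
    obtain ⟨l, rfl⟩ := hk
    omega
  have per := hf.periodic 0
  rw [zero_add] at per
  rcases hk' with rfl | rfl | rfl | rfl
  · have := hf.adj 0
    rw [zero_add, per] at this
    exact absurd this (G.loopless.irrefl _)
  · exact (ht _ _ _ (hf.adj 0) (hf.adj 1) (per ▸ hf.adj 2)).elim
  · exact (hno ⟨_, hf.mem 0, _, hf.mem 1, _, hf.mem 2, _, hf.mem 3, _, hf.mem 4, hf.adj 0, hf.adj 1,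
      hf.adj 2, hf.adj 3, per ▸ hf.adj 4⟩).elim
  · have hmod (n : ℕ) : f (n % 7) = f n := hf.periodic.map_mod_nat n
    refine ⟨fun i => f i, fun i j hij => Fin.ext (hinj i.2 j.2 hij), fun i => hf.mem _,
      fun i => ?_, fun i hi => ?_⟩
    · change G.Adj (f i) (f (i + 1 : Fin 7))
      rw [Fin.val_add, hmod]
      exact hf.adj _
    · change G.Adj (f i) (f (i + 4 : Fin 7)) at hi
      rw [Fin.val_add, hmod] at hi
      exact hno ⟨_, hf.mem _, _, hf.mem _, _, hf.mem _, _, hf.mem _, _, hf.mem _, hf.adj i,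
        hf.adj (i + 1), hf.adj (i + 2), hf.adj (i + 3), hi.symm⟩

lemma degree_ne_four [Fintype V] [DecidableEq V] [DecidableRel G.Adj] (hV : Fintype.card V = 12)
    (ho : G.OddCyclesMeet) (hα : G.IndepLeFour) (ht : G.TriangleFree) (v : V) :
    G.degree v ≠ 4 := by
  intro hv
  set H : Finset V := (insert v (G.neighborFinset v))ᶜ with hH
  have hvN : v ∉ G.neighborFinset v := by simp
  have hHcard : H.card = 7 := by
    rw [hH, Finset.card_compl, hV, Finset.card_insert_of_notMem hvN, card_neighborFinset_eq_degree,
      hv]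
  have hmem (x : V) : x ∈ H ↔ x ≠ v ∧ ¬ G.Adj v x := by simp [hH]
  have hb : ¬ G.BipartiteOn H := by
    intro hb
    obtain ⟨A, B, hA, hB, hAH, hBH, -, hcard⟩ := hb.exists_indep_split
    have main {A : Finset V} (hA : G.IsIndepSet (A : Set V)) (hAH : A ⊆ H) : A.card ≤ 3 := by
      have h1 := hα (insert v A) (by
        rw [Finset.coe_insert]
        exact hA.insert_of_forall fun y hy => ((hmem y).1 (hAH hy)).2)
      rw [Finset.card_insert_of_notMem fun h => ((hmem v).1 (hAH h)).1 rfl] at h1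
      omega
    have := main hA hAH
    have := main hB hBH
    omega
  rcases exists_pentagon_or_heptagon ht hHcard.le hb with
    ⟨c₀, h0, c₁, h1, c₂, h2, c₃, h3, c₄, h4, a0, a1, a2, a3, a4⟩ | ⟨F, hinj, hF, hadj, hchord⟩
  · have hsub : ({c₀, c₁, c₂, c₃, c₄} : Finset V) ⊆ H := by
      intro x hx
      simp only [Finset.mem_insert, Finset.mem_singleton] at hx
      rcases hx with rfl | rfl | rfl | rfl | rfl <;> assumption
    have hcard : 1 < (H \ {c₀, c₁, c₂, c₃, c₄}).card := by
      have := Finset.le_card_sdiff ({c₀, c₁, c₂, c₃, c₄} : Finset V) H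
      have h5 : ({c₀, c₁, c₂, c₃, c₄} : Finset V).card ≤ 5 := Finset.card_le_five
      omega
    obtain ⟨r, hr, s, hs, hrs⟩ := Finset.one_lt_card.1 hcard
    have d02 : c₀ ≠ c₂ := by rintro rfl; exact ht _ _ _ a2 a3 a4
    have d13 : c₁ ≠ c₃ := by rintro rfl; exact ht _ _ _ a3 a4 a0
    have d24 : c₂ ≠ c₄ := by rintro rfl; exact ht _ _ _ a4 a0 a1
    have d30 : c₃ ≠ c₀ := by rintro rfl; exact ht _ _ _ a0 a1 a2
    have d41 : c₄ ≠ c₁ := by rintro rfl; exact ht _ _ _ a1 a2 a3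
    have n0 := a0.ne
    have n1 := a1.ne
    have n2 := a2.ne
    have n3 := a3.ne
    have n4 := a4.ne
    simp only [Finset.mem_sdiff, Finset.mem_insert, Finset.mem_singleton, not_or, hmem] at hr hs
    rw [hmem] at h0 h1 h2 h3 h4
    refine PentagonPair.false_of_degree_eq_four (r := r) (s := s) (v := v)
      ⟨a0, a1, a2, a3, a4, ?_, ?_⟩ ho hα ht hv
    · simp only [List.mem_cons, List.not_mem_nil, or_false, forall_eq_or_imp, forall_eq]
      tauto
    · simp only [List.nodup_cons, List.mem_cons, List.not_mem_nil, or_false, not_or]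
      grind
  · exact heptagon_false_of_degree_eq_four hα ht hv hinj hadj hchord fun i => ((hmem _).1 (hF i)).2

/-- A graph on twelve vertices in which any two odd cycles meet has five independent vertices. -/
theorem exists_isIndepSet_of_oddCyclesMeet [Fintype V] (hV : Fintype.card V = 12)
    (ho : G.OddCyclesMeet) : ∃ s : Finset V, G.IsIndepSet (s : Set V) ∧ 5 ≤ s.card := by
  classical
  by_contra! hno
  have hα : G.IndepLeFour := fun s hs => Nat.le_of_lt_succ (hno s hs)
  have ht := triangleFree_of_indepLeFour hV ho hα
  have hdeg : ∀ v, G.degree v ≤ 3 := fun v => by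
    have h1 := hα _ (ht.isIndepSet_neighborFinset v)
    rw [card_neighborFinset_eq_degree] at h1
    have h2 := degree_ne_four hV ho hα ht v
    omega
  by_cases h3 : ∃ v, G.degree v = 3
  · obtain ⟨v, hv⟩ := h3
    obtain ⟨a, b, c, d, e, hab, hbc, hcd, hde, hea⟩ := exists_pentagon_of_degree_eq_three hV hα ht hv
    exact pentagon_false_of_degree_le_three hV ho hα ht hdeg hab hbc hcd hde hea
  · obtain ⟨s, -, hs, hcard⟩ := exists_isIndepSet_of_degree_le_two ht
      (fun v => by have := hdeg v; have : G.degree v ≠ 3 := fun h => h3 ⟨v, h⟩; omega) 3 Finset.univ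
      (by rw [Finset.card_univ, hV])
    have := hα s hs
    omega

end SimpleGraph

/-! ### Diameter graphs in space -/

lemma diameterGraph_oddCyclesMeet (X : Set (EuclideanSpace ℝ (Fin 3))) :
    (diameterGraph X).OddCyclesMeet := by
  intro S T hST
  by_contra! h
  obtain ⟨k, hk, f, hf⟩ := SimpleGraph.exists_isPeriodicWalk_of_not_bipartiteOn h.1
  obtain ⟨m, hm, g, hg⟩ := SimpleGraph.exists_isPeriodicWalk_of_not_bipartiteOn h.2
  have h0 := hf.adj 0
  have hD : 0 < dist (f 0) (f (0 + 1)) := dist_pos.2 h0.1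
  have hle (P Q : X) : dist (P : EuclideanSpace ℝ (Fin 3)) Q ≤ dist (f 0) (f (0 + 1)) := by
    by_cases hPQ : P = Q
    · rw [hPQ, dist_self]; exact hD.le
    · exact h0.2.2 ⟨P, P.2, Q, Q.2, fun h => hPQ (Subtype.ext h), rfl⟩
  obtain ⟨i, j, hij⟩ := odd_diameter_walks_meet (f := fun i => (f i : EuclideanSpace ℝ (Fin 3)))
    (g := fun i => (g i : EuclideanSpace ℝ (Fin 3))) hD hk hm
    (fun i => by rw [hf.periodic i]) (fun i => by rw [hg.periodic i])
    (fun i => (hf.adj i).2.unique h0.2) (fun j => (hg.adj j).2.unique h0.2)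
    (fun _ _ => hle _ _) (fun _ _ => hle _ _) (fun _ _ => hle _ _)
  exact Finset.disjoint_left.1 hST (hf.mem i) (Subtype.ext hij ▸ hg.mem j)

theorem proposition3p3 (X : Set (EuclideanSpace ℝ (Fin 3))) (hX : X.ncard = 12) :
    5 ≤ (diameterGraph X).indepNum := by
  have hfin : X.Finite := Set.finite_of_ncard_ne_zero (by rw [hX]; norm_num)
  have := hfin.fintype
  have hV : Fintype.card X = 12 := by rw [← hX, Set.ncard_eq_toFinset_card', Set.toFinset_card]
  obtain ⟨s, hs, hcard⟩ :=
    SimpleGraph.exists_isIndepSet_of_oddCyclesMeet hV (diameterGraph_oddCyclesMeet X)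
  exact hcard.trans hs.card_le_indepNum
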